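/- For a real $n\times n$ matrix $A$, let $\Pi(A)=\prod_{j=1}^n A_{jj}$ denote its diagonal product. For every integer $n\ge 1$, the image of the special orthogonal group $\mathrm{SO}(n)$ under $\Pi$ is $$\Pi(\mathrm{SO}(n)) = \left[-\left(1-\tfrac{2}{n}\right)^n,\ 1\right].$$ Moreover, for every $U\in \mathrm{SO}(n)$: - $\Pi(U)=1$ if and only if $U=\mathrm{diag}(\sigma_1,\dots,\sigma_n)$ for some $\sigma_1,\dots,\sigma_n\in\{-1,1\}$ with $\prod_j\sigma_j=1$; - $\Pi(U)=-\left(1-\tfrac{2}{n}\right)^n$ if and only if $U=(I-2uu^T)\,\mathrm{diag}(\sigma_1,\dots,\sigma_n)$ for some $u\in\mathbb{R}^n$ with $|u_k|=\tfrac{1}{\sqrt n}$ for all $k$ and some $\sigma_1,\dots,\sigma_n\in\{-1,1\}$ with $\prod_j\sigma_j=-1$. -/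

import Mathlib

/-- The diagonal product of a square matrix: the product of all its diagonal entries. -/
def diagProd {n : ℕ} (A : Matrix (Fin n) (Fin n) ℝ) : ℝ :=
  ∏ j, A j j

/-! Orthogonal matrices have entries in `[-1, 1]`, which gives the upper bound and its equality
case. For the minimum, suppose the diagonal product is nonpositive and flip column signs, with total
sign `-1`, so that the diagonal becomes `|U j j|`. The new matrix has determinant `-1`, hence a unit
eigenvector `v` for `-1`; multiplying by the reflection in `v` raises the trace by 2 and keeps it at
most `n`. So `∑ |U j j| ≤ n - 2`, and AM-GM finishes. Equality forces a reflection with constant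
diagonal. Intermediate values come from a path of reflections. -/

open Matrix in
theorem mem_specialOrthogonalGroup_iff_mul_transpose {ι : Type*} [Fintype ι] [DecidableEq ι]
    {A : Matrix ι ι ℝ} :
    A ∈ specialOrthogonalGroup ι ℝ ↔ A * Aᵀ = 1 ∧ A.det = 1 := by
  rw [mem_specialOrthogonalGroup_iff, mem_orthogonalGroup_iff]

/-- AM-GM inequality in product form. -/
theorem prod_le_pow_card_of_sum_le {ι : Type*} [Fintype ι] {x : ι → ℝ} {c : ℝ}
    (hx : ∀ i, 0 ≤ x i) (hc : 0 < c) (hs : ∑ i, x i ≤ Fintype.card ι * c) :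
    ∏ i, x i ≤ c ^ Fintype.card ι := by
  -- Use `y ≤ exp (y - 1)` at `y = x i / c`; the exponents sum to at most 0.
  have h1 : ∏ i, x i / c ≤ ∏ i, Real.exp (x i / c - 1) :=
    Finset.prod_le_prod (fun i _ => div_nonneg (hx i) hc.le)
      fun i _ => by linarith [Real.add_one_le_exp (x i / c - 1)]
  rw [← Real.exp_sum, Finset.sum_sub_distrib, ← Finset.sum_div, Finset.prod_div_distrib] at h1
  have h2 : (∑ i, x i) / c - ∑ _i : ι, (1 : ℝ) ≤ 0 := by
    simpa using (div_le_iff₀ hc).2 hs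
  have h3 := h1.trans (Real.exp_le_one_iff.2 h2)
  simpa using (div_le_one (by simp; positivity)).1 h3

theorem eq_of_prod_eq_pow_card {ι : Type*} [Fintype ι] {x : ι → ℝ} {c : ℝ}
    (hx : ∀ i, 0 ≤ x i) (hc : 0 < c) (hs : ∑ i, x i ≤ Fintype.card ι * c)
    (h : ∏ i, x i = c ^ Fintype.card ι) (i : ι) : x i = c := by
  by_contra hne
  have hpos : ∀ j, 0 < x j := fun j => (hx j).lt_of_ne fun h0 => by
    rw [Finset.prod_eq_zero (Finset.mem_univ j) h0.symm] at h
    exact (pow_pos hc _).ne h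
  have h1 : ∏ i, x i / c < ∏ i, Real.exp (x i / c - 1) := by
    refine Finset.prod_lt_prod (fun i _ => div_pos (hpos i) hc)
      (fun i _ => by linarith [Real.add_one_le_exp (x i / c - 1)]) ⟨i, Finset.mem_univ i, ?_⟩
    have : x i / c - 1 ≠ 0 := fun h0 => hne (by field_simp at h0; linarith)
    linarith [Real.add_one_lt_exp this]
  rw [← Real.exp_sum, Finset.sum_sub_distrib, ← Finset.sum_div, Finset.prod_div_distrib, h] at h1
  have h2 : (∑ i, x i) / c - ∑ _i : ι, (1 : ℝ) ≤ 0 := by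
    simpa using (div_le_iff₀ hc).2 hs
  have h3 := h1.trans_le (Real.exp_le_one_iff.2 h2)
  rw [Finset.prod_const, Finset.card_univ, div_self (pow_pos hc _).ne'] at h3
  exact lt_irrefl _ h3

/-- A real family with nonpositive product can be made nonnegative by signs of product `-1`. -/
theorem exists_signs_mul_eq_abs {ι : Type*} [Fintype ι] [DecidableEq ι] {x : ι → ℝ}
    (hx : ∏ i, x i ≤ 0) :
    ∃ σ : ι → ℝ, (∀ i, σ i ∈ ({-1, 1} : Set ℝ)) ∧ ∏ i, σ i = -1 ∧ ∀ i, x i * σ i = |x i| := by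
  set τ : ι → ℝ := fun i => if x i < 0 then -1 else 1 with hτ
  have hmem : ∀ i, τ i ∈ ({-1, 1} : Set ℝ) := fun i => by
    by_cases h : x i < 0 <;> simp [hτ, h]
  have habs : ∀ i, x i * τ i = |x i| := fun i => by
    by_cases h : x i < 0
    · simp [hτ, h, abs_of_neg]
    · simp [hτ, h, abs_of_nonneg (not_lt.1 h)]
  have hsq : ∏ i, τ i = 1 ∨ ∏ i, τ i = -1 := by
    rw [← sq_eq_one_iff, ← Finset.prod_pow]
    exact Finset.prod_eq_one fun i _ => sq_eq_one_iff.2 (hmem i).symm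
  rcases hsq with h1 | h1
  · have h2 : ∏ i, x i = ∏ i, |x i| := by
      rw [← mul_one (∏ i, x i), ← h1, ← Finset.prod_mul_distrib]
      exact Finset.prod_congr rfl fun i _ => habs i
    have h3 : ∏ i, x i = 0 :=
      le_antisymm hx (h2 ▸ Finset.prod_nonneg fun i _ => abs_nonneg _)
    obtain ⟨i, -, hi⟩ := Finset.prod_eq_zero_iff.1 h3
    -- The natural signs have the wrong product, so some entry vanishes, and its sign is free to
    -- flip.
    refine ⟨Function.update τ i (-1), fun j => ?_, ?_, fun j => ?_⟩
    · by_cases hj : j = i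
      · subst hj; simp
      · simpa [hj] using hmem j
    · have hτi : τ i = 1 := by simp [hτ, hi]
      rw [Finset.prod_eq_mul_prod_sdiff_singleton_of_mem (Finset.mem_univ i) τ, hτi,
        one_mul] at h1
      rw [Finset.prod_update_of_mem (Finset.mem_univ i), h1, mul_one]
    · by_cases hj : j = i
      · subst hj; simp [hi]
      · simpa [hj] using habs j
  · exact ⟨τ, hmem, h1, habs⟩

/-! ### Orthogonal matrices and reflections -/

namespace Matrix

variable {ι : Type*} [Fintype ι] [DecidableEq ι]

theorem sum_sq_row_eq_one {A : Matrix ι ι ℝ} (hA : A * Aᵀ = 1) (i : ι) :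
    ∑ j, A i j ^ 2 = 1 := by
  have := congrFun (congrFun hA i) i
  simpa [mul_apply, sq] using this

theorem abs_apply_le_one {A : Matrix ι ι ℝ} (hA : A * Aᵀ = 1) (i j : ι) : |A i j| ≤ 1 := by
  rw [← sq_le_one_iff_abs_le_one, ← sum_sq_row_eq_one hA i]
  exact Finset.single_le_sum (f := fun j => A i j ^ 2) (fun _ _ => sq_nonneg _)
    (Finset.mem_univ j)

theorem eq_diagonal_of_diag_sq_eq_one {A : Matrix ι ι ℝ} (hA : A * Aᵀ = 1)
    (h : ∀ i, A i i ^ 2 = 1) : A = diagonal fun i => A i i := by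
  ext i j
  by_cases hij : i = j
  · subst hij; simp
  · have h1 := sum_sq_row_eq_one hA i
    have h2 : ∑ k ∈ {i, j}, A i k ^ 2 ≤ ∑ k, A i k ^ 2 :=
      Finset.sum_le_sum_of_subset_of_nonneg (Finset.subset_univ _) fun _ _ _ => sq_nonneg _
    rw [Finset.sum_pair hij, h i, h1] at h2
    rw [diagonal_apply_ne _ hij]
    exact pow_eq_zero_iff two_ne_zero |>.1 (le_antisymm (by linarith) (sq_nonneg _))

/-- The Householder matrix of a vector. -/
abbrev householder {κ : Type*} [DecidableEq κ] (u : κ → ℝ) : Matrix κ κ ℝ := 1 - (2 : ℝ) • vecMulVec u u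

theorem householder_transpose {κ : Type*} [DecidableEq κ] (u : κ → ℝ) : (householder u)ᵀ = householder u := by
  simp [householder, transpose_sub, transpose_smul, transpose_vecMulVec]

theorem householder_mul_self {u : ι → ℝ} (hu : u ⬝ᵥ u = 1) :
    householder u * householder u = 1 := by
  simp only [householder, mul_sub, sub_mul, mul_one, one_mul, Matrix.smul_mul,
    Matrix.mul_smul,    vecMulVec_mul_vecMulVec, hu, one_smul]
  module

theorem det_householder (u : ι → ℝ) : (householder u).det = 1 - 2 * (u ⬝ᵥ u) := by
  have := det_one_add_replicateCol_mul_replicateRow (ι := Unit) ((-2 : ℝ) • u) u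
  rw [← vecMulVec_eq Unit, smul_vecMulVec, neg_smul, ← sub_eq_add_neg] at this
  rw [householder, this, dotProduct_smul, smul_eq_mul]
  ring

theorem diagonal_mul_self_of_signs {σ : ι → ℝ} (hσ : ∀ i, σ i ∈ ({-1, 1} : Set ℝ)) :
    diagonal σ * diagonal σ = 1 := by
  rw [diagonal_mul_diagonal, ← diagonal_one]
  congr 1
  ext i
  rcases hσ i with h | h
  · simp [h]
  · simp [Set.mem_singleton_iff.1 h]

theorem mul_diagonal_mul_transpose {A : Matrix ι ι ℝ} (hA : A * Aᵀ = 1) {σ : ι → ℝ}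
    (hσ : ∀ i, σ i ∈ ({-1, 1} : Set ℝ)) :
    (A * diagonal σ) * (A * diagonal σ)ᵀ = 1 := by
  rw [transpose_mul, diagonal_transpose, Matrix.mul_assoc, ← Matrix.mul_assoc (diagonal σ),
    diagonal_mul_self_of_signs hσ, Matrix.one_mul, hA]

theorem exists_mulVec_eq_neg_of_det_eq_neg_one {A : Matrix ι ι ℝ} (hA : A * Aᵀ = 1)
    (hdet : A.det = -1) : ∃ v : ι → ℝ, v ⬝ᵥ v = 1 ∧ A *ᵥ v = -v := by
  have h0 : (1 + A).det = 0 := by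
    -- Taking determinants gives `det (1 + A) = -det (1 + A)`.
    have h1 : A * (1 + A)ᵀ = 1 + A := by
      rw [transpose_add, transpose_one, Matrix.mul_add, hA, Matrix.mul_one, add_comm]
    have h2 := congrArg det h1
    rw [det_mul, det_transpose, hdet] at h2
    linarith
  obtain ⟨w, hw, hAw⟩ := exists_mulVec_eq_zero_iff.2 h0
  have hpos : 0 < w ⬝ᵥ w :=
    lt_of_le_of_ne (Finset.sum_nonneg fun i _ => mul_self_nonneg _)
      fun h => hw (dotProduct_self_eq_zero.1 h.symm)
  rw [add_mulVec, one_mulVec] at hAw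
  refine ⟨(√(w ⬝ᵥ w))⁻¹ • w, ?_, ?_⟩
  · rw [smul_dotProduct, dotProduct_smul, smul_eq_mul, smul_eq_mul, ← mul_assoc, ← mul_inv,
      Real.mul_self_sqrt hpos.le, inv_mul_cancel₀ hpos.ne']
  · rw [mulVec_smul, eq_neg_of_add_eq_zero_right hAw, smul_neg]

/-- An orthogonal matrix of determinant `-1` has trace at most `n - 2`, with equality only for
reflections. -/
theorem trace_le_of_det_eq_neg_one {A : Matrix ι ι ℝ} (hA : A * Aᵀ = 1) (hdet : A.det = -1) :
    ∃ v : ι → ℝ, A.trace ≤ Fintype.card ι - 2 ∧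
      (A.trace = Fintype.card ι - 2 → A = householder v) := by
  obtain ⟨v, hv, hAv⟩ := exists_mulVec_eq_neg_of_det_eq_neg_one hA hdet
  -- Since `A v = -v`, this is `A + 2 v vᵀ`, still orthogonal.
  set B := A * householder v with hB
  have hBo : B * Bᵀ = 1 := by
    rw [hB, transpose_mul, householder_transpose, Matrix.mul_assoc,
      ← Matrix.mul_assoc (householder v), householder_mul_self hv, Matrix.one_mul, hA]
  have htr : B.trace = A.trace + 2 := by
    rw [hB, householder, Matrix.mul_sub, Matrix.mul_one, Matrix.mul_smul, mul_vecMulVec, hAv,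
      trace_sub, trace_smul, trace_vecMulVec, neg_dotProduct, hv]
    norm_num
  have hle : ∀ i, B i i ≤ 1 := fun i => (le_abs_self _).trans (abs_apply_le_one hBo i i)
  refine ⟨v, ?_, fun heq => ?_⟩
  · have : B.trace ≤ ∑ _i : ι, (1 : ℝ) := Finset.sum_le_sum fun i _ => hle i
    rw [Finset.sum_const, Finset.card_univ, nsmul_eq_mul, mul_one] at this
    linarith
  · have h1 : ∑ i, B i i = ∑ _i : ι, (1 : ℝ) := by
      rw [Finset.sum_const, Finset.card_univ, nsmul_eq_mul, mul_one]
      exact htr.trans (by linarith)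
    have h2 := (Finset.sum_eq_sum_iff_of_le fun i _ => hle i).1 h1
    have h3 : B = 1 := by
      rw [eq_diagonal_of_diag_sq_eq_one hBo fun i => by rw [h2 i (Finset.mem_univ i), one_pow],
        ← diagonal_one]
      congr 1
      ext i
      exact h2 i (Finset.mem_univ i)
    rw [← Matrix.mul_one A, ← householder_mul_self hv, ← Matrix.mul_assoc, ← hB, h3,
      Matrix.one_mul]

end Matrix

open Matrix

/-! ### Extreme values and image of the diagonal product -/

section

variable {n : ℕ}

theorem abs_diagProd_le_one {U : Matrix (Fin n) (Fin n) ℝ} (hU : U * Uᵀ = 1) :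
    |diagProd U| ≤ 1 := by
  rw [diagProd, Finset.abs_prod]
  exact Finset.prod_le_one (fun _ _ => abs_nonneg _) fun i _ => abs_apply_le_one hU i i

theorem diag_sq_eq_one_of_diagProd_eq_one {U : Matrix (Fin n) (Fin n) ℝ} (hU : U * Uᵀ = 1)
    (h : diagProd U = 1) (i : Fin n) : U i i ^ 2 = 1 := by
  have h1 : |U i i| * ∏ j ∈ Finset.univ \ {i}, |U j j| = 1 := by
    rw [← Finset.prod_eq_mul_prod_sdiff_singleton_of_mem (Finset.mem_univ i) fun j => |U j j|,
      ← Finset.abs_prod]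
    exact (congrArg abs h).trans abs_one
  have h2 : ∏ j ∈ Finset.univ \ {i}, |U j j| ≤ 1 :=
    Finset.prod_le_one (fun _ _ => abs_nonneg _) fun j _ => abs_apply_le_one hU j j
  have h3 : |U i i| = 1 :=
    le_antisymm (abs_apply_le_one hU i i) (by nlinarith [abs_nonneg (U i i)])
  rw [← sq_abs, h3, one_pow]

theorem diagProd_diagonal (σ : Fin n → ℝ) : diagProd (diagonal σ) = ∏ j, σ j := by
  simp [diagProd]

theorem diagProd_mul_diagonal (A : Matrix (Fin n) (Fin n) ℝ) (σ : Fin n → ℝ) :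
    diagProd (A * diagonal σ) = diagProd A * ∏ j, σ j := by
  simp [diagProd, Finset.prod_mul_distrib]

theorem diagProd_householder (u : Fin n → ℝ) :
    diagProd (householder u) = ∏ j, (1 - 2 * u j ^ 2) := by
  simp [diagProd, householder, vecMulVec_apply, sq]

theorem householder_mul_diagonal_mem {u σ : Fin n → ℝ} (hu : u ⬝ᵥ u = 1)
    (hσ : ∀ j, σ j ∈ ({-1, 1} : Set ℝ)) (hσp : ∏ j, σ j = -1) :
    householder u * diagonal σ ∈ specialOrthogonalGroup (Fin n) ℝ := by
  rw [mem_specialOrthogonalGroup_iff_mul_transpose]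
  refine ⟨mul_diagonal_mul_transpose ?_ hσ, ?_⟩
  · rw [householder_transpose, householder_mul_self hu]
  · rw [det_mul, det_householder, det_diagonal, hu, hσp]
    norm_num

theorem diagProd_householder_mul_diagonal_of_abs {u σ : Fin n → ℝ}
    (hu : ∀ k, |u k| = 1 / √(n : ℝ)) (hσp : ∏ j, σ j = -1) :
    diagProd (householder u * diagonal σ) = -(1 - 2 / (n : ℝ)) ^ n := by
  have h : ∀ j, 1 - 2 * u j ^ 2 = 1 - 2 / (n : ℝ) := fun j => by
    rw [← sq_abs, hu, div_pow, one_pow, Real.sq_sqrt n.cast_nonneg]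
    ring
  rw [diagProd_mul_diagonal, diagProd_householder, hσp, Finset.prod_congr rfl fun j _ => h j]
  simp

theorem neg_pow_le_diagProd_and_eq (hn : 2 ≤ n) {U : Matrix (Fin n) (Fin n) ℝ}
    (hU : U * Uᵀ = 1) (hdet : U.det = 1) :
    -(1 - 2 / (n : ℝ)) ^ n ≤ diagProd U ∧
      (diagProd U = -(1 - 2 / (n : ℝ)) ^ n →
        ∃ (u σ : Fin n → ℝ), (∀ k, |u k| = 1 / √(n : ℝ)) ∧
          (∀ j, σ j ∈ ({-1, 1} : Set ℝ)) ∧ ∏ j, σ j = -1 ∧ U = householder u * diagonal σ) := by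
  have hn' : (2 : ℝ) ≤ n := by exact_mod_cast hn
  have hn0 : (0 : ℝ) < n := by linarith
  have hc : 0 ≤ 1 - 2 / (n : ℝ) := sub_nonneg.2 ((div_le_one hn0).2 hn')
  have hcn : (n : ℝ) * (1 - 2 / (n : ℝ)) = n - 2 := by field_simp
  rcases lt_or_ge 0 (diagProd U) with hpos | hneg
  · have := pow_nonneg hc n
    exact ⟨by linarith, fun h => by linarith⟩
  obtain ⟨σ, hσ, hσp, habs⟩ := exists_signs_mul_eq_abs hneg
  have hA := mul_diagonal_mul_transpose hU hσ
  have hAdet : (U * diagonal σ).det = -1 := by rw [det_mul, det_diagonal, hdet, hσp, one_mul]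
  obtain ⟨v, htr, heq⟩ := trace_le_of_det_eq_neg_one hA hAdet
  have hdiag : ∀ j, (U * diagonal σ) j j = |U j j| := fun j => by rw [mul_diagonal, habs]
  have htr' : (U * diagonal σ).trace = ∑ j, |U j j| := Finset.sum_congr rfl fun j _ => hdiag j
  rw [htr', Fintype.card_fin] at htr heq
  have hprod : diagProd U = -∏ j, |U j j| := by
    rw [← Finset.abs_prod]
    exact (neg_eq_iff_eq_neg.1 (abs_of_nonpos hneg).symm)
  -- The AM-GM lemmas need a positive mean; when `n = 2` the trace bound is 0 and kills every
  -- diagonal entry.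
  have hall : (0 < 1 - 2 / (n : ℝ)) ∨ ∀ j, |U j j| = 1 - 2 / (n : ℝ) := by
    rcases hc.lt_or_eq with h | h
    · exact Or.inl h
    · right
      rw [← h, mul_zero] at hcn
      rw [← hcn] at htr
      intro j
      rw [← h]
      exact (Finset.sum_eq_zero_iff_of_nonneg fun j _ => abs_nonneg (U j j)).1
        (le_antisymm htr (Finset.sum_nonneg fun j _ => abs_nonneg _)) j (Finset.mem_univ j)
  have hs : ∑ j, |U j j| ≤ Fintype.card (Fin n) * (1 - 2 / (n : ℝ)) := by
    rw [Fintype.card_fin, hcn]; exact htr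
  constructor
  · rw [hprod, neg_le_neg_iff]
    rcases hall with h | h
    · simpa using prod_le_pow_card_of_sum_le (fun j => abs_nonneg (U j j)) h hs
    · simp [h]
  · intro h
    have hj : ∀ j, |U j j| = 1 - 2 / (n : ℝ) := by
      rcases hall with h' | h'
      · refine eq_of_prod_eq_pow_card (fun j => abs_nonneg (U j j)) h' hs ?_
        rw [Fintype.card_fin]
        linarith
      · exact h'
    have hAv := heq (by
      rw [Finset.sum_congr rfl fun j _ => hj j, Finset.sum_const, Finset.card_univ,
        Fintype.card_fin, nsmul_eq_mul, hcn])
    refine ⟨v, σ, fun k => ?_, hσ, hσp, ?_⟩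
    · have h1 := hdiag k
      rw [hAv, hj k] at h1
      have h2 : v k ^ 2 = 1 / n := by
        simp only [householder, Matrix.sub_apply, one_apply_eq, Matrix.smul_apply, vecMulVec_apply,
          smul_eq_mul] at h1
        linear_combination -h1 / 2
      rw [← Real.sqrt_sq_eq_abs, h2, Real.sqrt_div zero_le_one, Real.sqrt_one]
    · rw [← hAv, Matrix.mul_assoc, diagonal_mul_self_of_signs hσ, Matrix.mul_one]

theorem Icc_subset_image_diagProd (hn : 1 ≤ n) :
    Set.Icc (-(1 - 2 / (n : ℝ)) ^ n) 1 ⊆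
      diagProd '' (specialOrthogonalGroup (Fin n) ℝ : Set (Matrix (Fin n) (Fin n) ℝ)) := by
  have hn0 : (n : ℝ) ≠ 0 := by positivity
  let i₀ : Fin n := ⟨0, hn⟩
  let σ : Fin n → ℝ := Function.update 1 i₀ (-1)
  have hσ : ∀ j, σ j ∈ ({-1, 1} : Set ℝ) := fun j => by
    by_cases hj : j = i₀
    · subst hj; simp [σ]
    · simp [σ, hj]
  have hσp : ∏ j, σ j = -1 := by
    simp [σ, Finset.prod_update_of_mem]
  -- Squared coordinates of a unit vector moving from a basis vector (where reflection times `σ` is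
  -- the identity) to a uniform one (the minimum).
  let w : ℝ → Fin n → ℝ := fun t j => t / n + (1 - t) * (Pi.single i₀ 1 : Fin n → ℝ) j
  let f : ℝ → ℝ := fun t => -∏ j, (1 - 2 * w t j)
  have hf : Continuous f := by fun_prop
  have hf0 : f 0 = 1 := by
    have : ∀ j, 1 - 2 * w 0 j = σ j := fun j => by
      by_cases hj : j = i₀
      · subst hj; norm_num [w, σ]
      · simp [w, σ, hj]
    simp [f, this, hσp]
  have hf1 : f 1 = -(1 - 2 / (n : ℝ)) ^ n := by
    simp [f, w, div_eq_mul_inv]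
  intro y hy
  obtain ⟨t, ht, rfl⟩ := intermediate_value_Icc' zero_le_one hf.continuousOn
    (show y ∈ Set.Icc (f 1) (f 0) by rwa [hf0, hf1])
  have hw : ∀ j, 0 ≤ w t j := fun j => by
    have : (0 : ℝ) ≤ (Pi.single i₀ 1 : Fin n → ℝ) j := by
      by_cases hj : j = i₀
      · subst hj; simp
      · simp [hj]
    exact add_nonneg (div_nonneg ht.1 n.cast_nonneg) (mul_nonneg (by linarith [ht.2]) this)
  refine ⟨householder (fun j => √(w t j)) * diagonal σ,
    householder_mul_diagonal_mem ?_ hσ hσp, ?_⟩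
  · simp only [dotProduct, Real.mul_self_sqrt (hw _)]
    simp only [w, Finset.sum_add_distrib, ← Finset.mul_sum, Finset.sum_pi_single',
      Finset.sum_const, Finset.card_univ, Fintype.card_fin, nsmul_eq_mul]
    rw [mul_div_cancel₀ _ hn0]
    simp
  · rw [diagProd_mul_diagonal, diagProd_householder, hσp]
    simp only [Real.sq_sqrt (hw _), f]
    ring

end

theorem corollary1 (n : ℕ) (hn : 1 ≤ n) :
    (diagProd '' (Matrix.specialOrthogonalGroup (Fin n) ℝ : Set (Matrix (Fin n) (Fin n) ℝ)) =
      Set.Icc (-(1 - 2 / (n : ℝ)) ^ n) 1) ∧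
    ∀ U ∈ Matrix.specialOrthogonalGroup (Fin n) ℝ,
      (diagProd U = 1 ↔
        ∃ σ : Fin n → ℝ, (∀ j, σ j ∈ ({-1, 1} : Set ℝ)) ∧ ∏ j, σ j = 1 ∧
          U = Matrix.diagonal σ) ∧
      (diagProd U = -(1 - 2 / (n : ℝ)) ^ n ↔
        ∃ (u σ : Fin n → ℝ), (∀ k, |u k| = 1 / √(n : ℝ)) ∧
          (∀ j, σ j ∈ ({-1, 1} : Set ℝ)) ∧ ∏ j, σ j = -1 ∧
          U = (1 - (2 : ℝ) • Matrix.vecMulVec u u) * Matrix.diagonal σ) := by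
  have hmin : ∀ U ∈ specialOrthogonalGroup (Fin n) ℝ,
      -(1 - 2 / (n : ℝ)) ^ n ≤ diagProd U ∧
        (diagProd U = -(1 - 2 / (n : ℝ)) ^ n →
          ∃ (u σ : Fin n → ℝ), (∀ k, |u k| = 1 / √(n : ℝ)) ∧
            (∀ j, σ j ∈ ({-1, 1} : Set ℝ)) ∧ ∏ j, σ j = -1 ∧
            U = householder u * diagonal σ) := by
    intro U hU
    obtain ⟨hUo, hdet⟩ := mem_specialOrthogonalGroup_iff_mul_transpose.1 hU
    rcases hn.eq_or_lt with rfl | hn2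
    · rw [det_fin_one] at hdet
      -- For `n = 1` the base `1 - 2/n` is `-1`, so both endpoints equal 1 and `U = 1 = (1 -
      -- 2)(-1)`.
      refine ⟨by norm_num [diagProd, hdet], fun _ => ⟨1, -1, by simp, by simp, by simp, ?_⟩⟩
      ext i j
      fin_cases i; fin_cases j
      norm_num [hdet, householder, vecMulVec_apply]
    · exact neg_pow_le_diagProd_and_eq hn2 hUo hdet
  refine ⟨Set.Subset.antisymm ?_ (Icc_subset_image_diagProd hn), fun U hU => ⟨⟨fun h => ?_, ?_⟩,
    (hmin U hU).2, ?_⟩⟩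
  · rintro _ ⟨U, hU, rfl⟩
    exact ⟨(hmin U hU).1, (le_abs_self _).trans
      (abs_diagProd_le_one (mem_specialOrthogonalGroup_iff_mul_transpose.1 hU).1)⟩
  · have hUo := (mem_specialOrthogonalGroup_iff_mul_transpose.1 hU).1
    have hsq := diag_sq_eq_one_of_diagProd_eq_one hUo h
    exact ⟨fun j => U j j, fun j => (sq_eq_one_iff.1 (hsq j)).symm, h,
      eq_diagonal_of_diag_sq_eq_one hUo hsq⟩
  · rintro ⟨σ, -, hσp, rfl⟩
    rw [diagProd_diagonal, hσp]
  · rintro ⟨u, σ, hu, -, hσp, rfl⟩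
    exact diagProd_householder_mul_diagonal_of_abs hu hσp
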